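/- **Polyominoes.** A polyomino is a finite nonempty set of unit cells of the lattice $\mathbb Z\times\mathbb Z$ that is connected through edges of cells; it has no holes if the cells outside it also form a set connected through edges. It is convex if each of its rows and each of its columns is connected. **Permutominoes.** Let $P$ be a polyomino without holes, with $n-1$ rows and $n-1$ columns, $n\ge 2$, placed so that the south-west corner of its minimal bounding rectangle is $(1,1)$. Let $A_1,\dots,A_{2(r+1)}$ be the vertices (corners of the boundary) of $P$, listed clockwise starting from the lowest leftmost vertex. $P$ is a permutomino of size $n$ if there are permutations $\pi_1(P),\pi_2(P)\in S_n$ with $$\{A_1,A_3,\dots,A_{2r+1}\}=\{(i,\pi_1(P)(i)):1\le i\le n\},\qquad \{A_2,A_4,\dots,A_{2r+2}\}=\{(i,\pi_2(P)(i)):1\le i\le n\}.$$ Let $\widetilde{\mathcal C}_n=\{\pi_1(P): P \text{ a convex permutomino of size } n\}\subseteq S_n$, where by convention there is also the empty permutomino of size $1$, associated with the permutation $(1)$. **The sublist $\sigma(\pi)$.** For $\pi\in S_n$, let $\mu(\pi)$ be the sublist of $\pi$ consisting of its left-right maxima (entries $\pi(i)$ with $\pi(j)<\pi(i)$ for all $j<i$)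 followed by its right-left maxima (entries $\pi(i)$ with $\pi(j)<\pi(i)$ for all $j>i$). Let $\sigma(\pi)$ be the sublist of $\pi$ consisting of $\pi(1)$, $\pi(n)$ and all the entries of $\pi$ that do not belong to $\mu(\pi)$. A sequence is lower unimodal if it strictly decreases up to one of its entries and strictly increases from that entry on (either part may consist of that single entry). **Direct difference.** For $\theta\in S_m$ and $\theta'\in S_{m'}$ let $\theta\ominus\theta'=(\theta_1+m',\dots,\theta_m+m',\theta'_1,\dots,\theta'_{m'})\in S_{m+m'}$. **Corollary.** Let $n\ge 1$ and let $\pi\in S_n$ be such that $\pi(1)<\pi(n)$. Then $\pi\in\widetilde{\mathcal C}_n$ if and only if $\sigma(\pi)$ is lower unimodal. Moreover, such a $\pi$ is never a direct difference: there are no $m,m'\ge 1$ with $m+m'=n$ and permutations $\theta\in S_m$, $\theta'\in S_{m'}$ with $\pi=\theta\ominus\theta'$. -/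

import Mathlib

/-! A cell is indexed by its south-west corner: `(i, j)` stands for `[i, i+1] × [j, j+1]`. -/

/-- Two cells are adjacent when they share an edge. -/
def cellGraph : SimpleGraph (ℤ × ℤ) where
  Adj a b := |a.1 - b.1| + |a.2 - b.2| = 1
  symm := ⟨fun a b h => by rw [abs_sub_comm b.1, abs_sub_comm b.2]; exact h⟩
  loopless := ⟨fun a h => by simp at h⟩

/-- A polyomino: a finite nonempty set of cells, connected through edges of cells
(connectedness through shared corners alone is not enough: such a corner is a cut point). -/
def IsPolyomino (P : Finset (ℤ × ℤ)) : Prop :=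
  (cellGraph.induce (P : Set (ℤ × ℤ))).Connected

/-- No holes: the cells outside `P` form a single region of the plane. -/
def HasNoHoles (P : Finset (ℤ × ℤ)) : Prop :=
  (cellGraph.induce ((P : Set (ℤ × ℤ))ᶜ)).Connected

/-- Every column is connected. -/
def IsColumnConvex (P : Finset (ℤ × ℤ)) : Prop :=
  ∀ x y₁ y y₂ : ℤ, y₁ ≤ y → y ≤ y₂ → (x, y₁) ∈ P → (x, y₂) ∈ P → (x, y) ∈ P

/-- Every row is connected. -/
def IsRowConvex (P : Finset (ℤ × ℤ)) : Prop :=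
  ∀ y x₁ x x₂ : ℤ, x₁ ≤ x → x ≤ x₂ → (x₁, y) ∈ P → (x₂, y) ∈ P → (x, y) ∈ P

/-- The south-west corner of the minimal bounding rectangle is `(1, 1)`. -/
def IsPlaced (P : Finset (ℤ × ℤ)) : Prop :=
  (∀ c ∈ P, 1 ≤ c.1 ∧ 1 ≤ c.2) ∧ (∃ c ∈ P, c.1 = 1) ∧ (∃ c ∈ P, c.2 = 1)

/-- The unit segment from `(x, y)` to `(x, y + 1)` lies on the boundary of `P`. -/
def IsVerticalBoundaryEdge (P : Finset (ℤ × ℤ)) (x y : ℤ) : Prop :=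
  Xor ((x - 1, y) ∈ P) ((x, y) ∈ P)

/-- The unit segment from `(x, y)` to `(x + 1, y)` lies on the boundary of `P`. -/
def IsHorizontalBoundaryEdge (P : Finset (ℤ × ℤ)) (x y : ℤ) : Prop :=
  Xor ((x, y - 1) ∈ P) ((x, y) ∈ P)

/-- A vertex of `P`: a lattice point at which a vertical and a horizontal boundary edge meet. -/
def IsVertex (P : Finset (ℤ × ℤ)) (v : ℤ × ℤ) : Prop :=
  (IsVerticalBoundaryEdge P v.1 v.2 ∨ IsVerticalBoundaryEdge P v.1 (v.2 - 1)) ∧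
  (IsHorizontalBoundaryEdge P v.1 v.2 ∨ IsHorizontalBoundaryEdge P (v.1 - 1) v.2)

/-- One can walk straight (north, east, south or west) from `v` to `w ≠ v` along the boundary in
the clockwise sense: all along, the cell on the right is in `P` and the cell on the left is not. -/
def IsClockwiseSide (P : Finset (ℤ × ℤ)) (v w : ℤ × ℤ) : Prop :=
  (v.1 = w.1 ∧ v.2 < w.2 ∧ ∀ y, v.2 ≤ y → y < w.2 → (v.1, y) ∈ P ∧ (v.1 - 1, y) ∉ P) ∨
  (v.2 = w.2 ∧ v.1 < w.1 ∧ ∀ x, v.1 ≤ x → x < w.1 → (x, v.2 - 1) ∈ P ∧ (x, v.2) ∉ P) ∨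
  (v.1 = w.1 ∧ w.2 < v.2 ∧ ∀ y, w.2 ≤ y → y < v.2 → (v.1 - 1, y) ∈ P ∧ (v.1, y) ∉ P) ∨
  (v.2 = w.2 ∧ w.1 < v.1 ∧ ∀ x, w.1 ≤ x → x < v.1 → (x, v.2) ∈ P ∧ (x, v.2 - 1) ∉ P)

/-- `A 1, …, A (2 (r + 1))` is the list of the vertices of `P`, in clockwise order, starting from
the lowest leftmost vertex; `A (2 (r + 1) + 1) = A 1` closes the boundary. -/
structure IsClockwiseVertexList (P : Finset (ℤ × ℤ)) (r : ℕ) (A : ℕ → ℤ × ℤ) : Prop where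
  injOn : Set.InjOn A (Set.Icc 1 (2 * (r + 1)))
  image_eq : A '' Set.Icc 1 (2 * (r + 1)) = {v | IsVertex P v}
  closed : A (2 * (r + 1) + 1) = A 1
  side : ∀ i, 1 ≤ i → i ≤ 2 * (r + 1) → IsClockwiseSide P (A i) (A (i + 1))
  start : ∀ v, IsVertex P v → (A 1).1 < v.1 ∨ ((A 1).1 = v.1 ∧ (A 1).2 ≤ v.2)

/-- A set of lattice points represents the permutation `π` of `{1, …, n}` when it is the set of
the points `(i, π(i))`. (`Fin n` is `{0, …, n - 1}`, whence the shift by one.) -/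
def Represents {n : ℕ} (S : Set (ℤ × ℤ)) (π : Equiv.Perm (Fin n)) : Prop :=
  S = Set.range fun i : Fin n => (((i : ℕ) : ℤ) + 1, ((π i : ℕ) : ℤ) + 1)

/-- A (nonempty) permutomino of size `n`, with its two permutations. -/
structure Permutomino (n : ℕ) where
  cells : Finset (ℤ × ℤ)
  perm₁ : Equiv.Perm (Fin n)
  perm₂ : Equiv.Perm (Fin n)
  isPolyomino : IsPolyomino cells
  hasNoHoles : HasNoHoles cells
  isPlaced : IsPlaced cells
  card_columns : (cells.image Prod.fst).card + 1 = n
  card_rows : (cells.image Prod.snd).card + 1 = n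
  represents : ∃ (r : ℕ) (A : ℕ → ℤ × ℤ), IsClockwiseVertexList cells r A ∧
    Represents {v | ∃ k ≤ r, v = A (2 * k + 1)} perm₁ ∧
    Represents {v | ∃ k ≤ r, v = A (2 * k + 2)} perm₂

/-- Convex permutominoes: row convex and column convex. -/
def Permutomino.IsConvex {n : ℕ} (P : Permutomino n) : Prop :=
  IsColumnConvex P.cells ∧ IsRowConvex P.cells

/-- The set `C̃ₙ` of the permutations `π₁(P)`, `P` a convex permutomino of size `n`; by convention
there is also the empty permutomino of size `1`, associated with the permutation `(1)`. -/
def convexPermutominoPerms (n : ℕ) : Set (Equiv.Perm (Fin n)) :=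
  {π | n = 1 ∨ ∃ P : Permutomino n, P.IsConvex ∧ P.perm₁ = π}

/-- `π i` is a left-right maximum. -/
def IsLeftRightMax {n : ℕ} (π : Equiv.Perm (Fin n)) (i : Fin n) : Prop :=
  ∀ j, j < i → π j < π i

/-- `π i` is a right-left maximum. -/
def IsRightLeftMax {n : ℕ} (π : Equiv.Perm (Fin n)) (i : Fin n) : Prop :=
  ∀ j, i < j → π j < π i

/-- The positions of the entries of the maximal upper unimodal sublist `μ(π)`: the left-right
maxima followed by the right-left maxima. -/
def muPositions {n : ℕ} (π : Equiv.Perm (Fin n)) : Set (Fin n) :=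
  {i | IsLeftRightMax π i ∨ IsRightLeftMax π i}

/-- The positions of the entries of the sublist `σ(π)`: the first position, the last one, and all
those that are not positions of `μ(π)`. -/
def sigmaPositions {n : ℕ} (π : Equiv.Perm (Fin n)) : Set (Fin n) :=
  {i | (i : ℕ) = 0 ∨ (i : ℕ) + 1 = n ∨ i ∉ muPositions π}

/-- The sublist of `π` at the positions in `S` is lower unimodal: it decreases up to one of its
entries and increases from there on. -/
def IsLowerUnimodalOn {n : ℕ} (π : Equiv.Perm (Fin n)) (S : Set (Fin n)) : Prop :=
  ∃ k ∈ S, StrictAntiOn π {i | i ∈ S ∧ i ≤ k} ∧ StrictMonoOn π {i | i ∈ S ∧ k ≤ i}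

/-- The direct difference `θ ⊖ θ' = (θ₁ + m', …, θₘ + m', θ'₁, …, θ'ₘ')`. -/
def directDifference {m m' : ℕ} (θ : Equiv.Perm (Fin m)) (θ' : Equiv.Perm (Fin m')) :
    Equiv.Perm (Fin (m + m')) :=
  finSumFinEquiv.symm.trans ((Equiv.sumCongr θ θ').trans ((Equiv.sumComm (Fin m) (Fin m')).trans
    (finSumFinEquiv.trans (finCongr (Nat.add_comm m' m)))))

/-- `π` is the direct difference of two (nonempty) permutations. -/
def IsDirectDifference {n : ℕ} (π : Equiv.Perm (Fin n)) : Prop :=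
  ∃ (m m' : ℕ) (_ : 0 < m) (_ : 0 < m') (h : m + m' = n)
    (θ : Equiv.Perm (Fin m)) (θ' : Equiv.Perm (Fin m')),
    π = (finCongr h).permCongr (directDifference θ θ')

/-! A column convex polyomino is a strip: column `x` fills the heights from `L x` to `U x`, and
consecutive columns share a row. If it is also row convex, `L` falls and then rises (weakly), and
`U` rises and then falls (`lower_le_max`, `min_le_upper`).

Let `π` be the first permutation of a convex permutomino. Sides leaving odd vertices are vertical,
since otherwise two vertices of the same parity would share a coordinate. So the odd vertex at each
abscissa lies on `L` of the column to its right, or on `U` of the column to its left where `U`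
changes. Away from the ends, the second kind is a record of `π`, because `U` is unimodal. Hence the
entries of `σ(π)` before the last lie on `L`, and the shape of `L` makes `σ(π)` lower unimodal.

Conversely, draw the upper boundary through `μ(π)` and the lower one through `σ(π)`. Unimodality and
`π(1) < π(n)` keep the lower boundary below the upper one (`sigma_lt_mu`), so they bound a strip.
Clockwise, its boundary visits the positions forwards through `μ(π)` and backwards through `σ(π)`.
If `s` is the successor in this cyclic order, the only vertical side at position `i` goes from
height `π i` to height `π (s i)`; the two permutations are therefore `π` and `π ∘ s`.

In a direct difference the last entry is less than the first. -/

/-! ### Paths of cells -/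

/-- The cells `a` and `b` are joined by a path of cells of `S`. -/
def CellJoined (S : Set (ℤ × ℤ)) (a b : ℤ × ℤ) : Prop :=
  ∃ (ha : a ∈ S) (hb : b ∈ S), (cellGraph.induce S).Reachable ⟨a, ha⟩ ⟨b, hb⟩

namespace CellJoined

variable {S : Set (ℤ × ℤ)} {a b c : ℤ × ℤ}

theorem refl (ha : a ∈ S) : CellJoined S a a := ⟨ha, ha, SimpleGraph.Reachable.refl _⟩

theorem symm (h : CellJoined S a b) : CellJoined S b a := by
  obtain ⟨ha, hb, h⟩ := h
  exact ⟨hb, ha, h.symm⟩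

theorem trans (h : CellJoined S a b) (h' : CellJoined S b c) : CellJoined S a c := by
  obtain ⟨ha, _, h⟩ := h
  obtain ⟨_, hc, h'⟩ := h'
  exact ⟨ha, hc, h.trans h'⟩

theorem of_adj (ha : a ∈ S) (hb : b ∈ S) (h : cellGraph.Adj a b) : CellJoined S a b :=
  ⟨ha, hb, SimpleGraph.Adj.reachable (by simpa using h)⟩

theorem vertical_of_le (x : ℤ) {y z : ℤ} (hyz : y ≤ z)
    (h : ∀ w, y ≤ w → w ≤ z → (x, w) ∈ S) : CellJoined S (x, y) (x, z) := by
  induction z, hyz using Int.leInduction with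
  | base => exact refl (h y le_rfl le_rfl)
  | succ z hz ih =>
    refine (ih fun w h₁ h₂ => h w h₁ (by omega)).trans
      (of_adj (h z hz (by omega)) (h (z + 1) (by omega) le_rfl) ?_)
    simp [cellGraph]

theorem horizontal_of_le (y : ℤ) {x z : ℤ} (hxz : x ≤ z)
    (h : ∀ w, x ≤ w → w ≤ z → (w, y) ∈ S) : CellJoined S (x, y) (z, y) := by
  induction z, hxz using Int.leInduction with
  | base => exact refl (h x le_rfl le_rfl)
  | succ z hz ih =>
    refine (ih fun w h₁ h₂ => h w h₁ (by omega)).trans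
      (of_adj (h z hz (by omega)) (h (z + 1) (by omega) le_rfl) ?_)
    simp [cellGraph]

theorem vertical (x y z : ℤ) (h : ∀ w, min y z ≤ w → w ≤ max y z → (x, w) ∈ S) :
    CellJoined S (x, y) (x, z) := by
  rcases le_total y z with hyz | hyz
  · exact vertical_of_le x hyz fun w h₁ h₂ => h w (by omega) (by omega)
  · exact (vertical_of_le x hyz fun w h₁ h₂ => h w (by omega) (by omega)).symm

theorem horizontal (y x z : ℤ) (h : ∀ w, min x z ≤ w → w ≤ max x z → (w, y) ∈ S) :
    CellJoined S (x, y) (z, y) := by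
  rcases le_total x z with hxz | hxz
  · exact horizontal_of_le y hxz fun w h₁ h₂ => h w (by omega) (by omega)
  · exact (horizontal_of_le y hxz fun w h₁ h₂ => h w (by omega) (by omega)).symm

theorem connected (o : ℤ × ℤ) (ho : o ∈ S) (h : ∀ a ∈ S, CellJoined S a o) :
    (cellGraph.induce S).Connected := by
  have : Nonempty S := ⟨⟨o, ho⟩⟩
  refine ⟨fun a b => ?_⟩
  obtain ⟨_, _, h₁⟩ := h a a.2
  obtain ⟨_, _, h₂⟩ := h b b.2
  exact h₁.trans h₂.symm

end CellJoined

/-! ### Strips -/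

/-- `P` has the columns `1, …, n - 1`, column `x` consists of the cells `(x, y)` with
`L x ≤ y < U x`, and any two consecutive columns share a row. -/
structure IsStrip (P : Finset (ℤ × ℤ)) (n : ℤ) (L U : ℤ → ℤ) : Prop where
  two_le : 2 ≤ n
  mem : ∀ x y, (x, y) ∈ P ↔ 1 ≤ x ∧ x < n ∧ L x ≤ y ∧ y < U x
  lt : ∀ x, 1 ≤ x → x < n → L x < U x
  lt_succ : ∀ x, 1 ≤ x → x + 1 < n → L x < U (x + 1)
  succ_lt : ∀ x, 1 ≤ x → x + 1 < n → L (x + 1) < U x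

namespace IsStrip

variable {P : Finset (ℤ × ℤ)} {n : ℤ} {L U : ℤ → ℤ}

theorem lt_pred (hP : IsStrip P n L U) (x : ℤ) (h₁ : 2 ≤ x) (h₂ : x < n) : L x < U (x - 1) := by
  simpa using hP.succ_lt (x - 1) (by omega) (by omega)

theorem pred_lt (hP : IsStrip P n L U) (x : ℤ) (h₁ : 2 ≤ x) (h₂ : x < n) : L (x - 1) < U x := by
  simpa using hP.lt_succ (x - 1) (by omega) (by omega)

theorem isColumnConvex (hP : IsStrip P n L U) : IsColumnConvex P := by
  intro x y₁ y y₂ h₁ h₂ h₃ h₄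
  rw [hP.mem] at *
  omega

theorem isPolyomino (hP : IsStrip P n L U) : IsPolyomino P := by
  have column : ∀ x y z, (x, y) ∈ P → (x, z) ∈ P → CellJoined (P : Set (ℤ × ℤ)) (x, y) (x, z) := by
    intro x y z hy hz
    refine CellJoined.vertical x y z fun w h₁ h₂ => ?_
    rw [Finset.mem_coe]
    rw [hP.mem] at *
    omega
  have bottom : ∀ x, 1 ≤ x → x < n → (x, L x) ∈ P := fun x h₁ h₂ =>
    (hP.mem _ _).2 ⟨h₁, h₂, le_rfl, hP.lt x h₁ h₂⟩
  have first : (1, L 1) ∈ P := bottom 1 le_rfl (by have := hP.two_le; omega)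
  have step : ∀ x, 1 ≤ x → x < n → CellJoined (P : Set (ℤ × ℤ)) (x, L x) (1, L 1) := by
    intro x hx
    induction x, hx using Int.leInduction with
    | base => exact fun _ => CellJoined.refl first
    | succ x hx ih =>
      intro hn
      have h₁ := hP.lt x hx (by omega)
      have h₂ := hP.lt (x + 1) (by omega) hn
      have h₃ := hP.lt_succ x hx hn
      have h₄ := hP.succ_lt x hx hn
      have hl : (x, max (L x) (L (x + 1))) ∈ P := by rw [hP.mem]; omega
      have hr : (x + 1, max (L x) (L (x + 1))) ∈ P := by rw [hP.mem]; omega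
      refine (column _ _ _ (bottom _ (by omega) hn) hr).trans (.trans (.of_adj hr hl ?_)
        ((column _ _ _ hl (bottom x hx (by omega))).trans (ih (by omega))))
      simp [cellGraph]
  refine CellJoined.connected (1, L 1) first fun a ha => ?_
  obtain ⟨x, y⟩ := a
  have h := (hP.mem x y).1 ha
  exact (column x y _ ha (bottom x h.1 h.2.1)).trans (step x h.1 h.2.1)

/-- A cell outside the strip can leave vertically, away from its column, to a height `±N` or beyond,
where no cell of `P` remains; from there it reaches the empty column `0`. -/
theorem hasNoHoles (hP : IsStrip P n L U) : HasNoHoles P := by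
  obtain ⟨N, hN⟩ : ∃ N, 0 ≤ N ∧ ∀ c ∈ P, -N < c.2 ∧ c.2 < N := by
    refine ⟨P.sum (fun c => |c.2|) + 1, ?_, fun c hc => ?_⟩
    · have := Finset.sum_nonneg (s := P) (f := fun c => |c.2|) fun _ _ => abs_nonneg _
      omega
    · have := Finset.single_le_sum (s := P) (f := fun c => |c.2|) (fun _ _ => abs_nonneg _) hc
      have h := abs_le.1 (show |c.2| ≤ _ from this)
      omega
  have outside : ∀ x y, (x < 1 ∨ y ≤ -N ∨ N ≤ y) → (x, y) ∈ ((P : Set (ℤ × ℤ))ᶜ) := by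
    intro x y h hxy
    have h₁ := (hP.mem x y).1 hxy
    have h₂ := hN.2 _ hxy
    simp only at h₂
    omega
  have key : ∀ x y z, (z ≤ -N ∨ N ≤ z) →
      (∀ w, min y z ≤ w → w ≤ max y z → (x, w) ∈ ((P : Set (ℤ × ℤ))ᶜ)) →
      CellJoined ((P : Set (ℤ × ℤ))ᶜ) (x, y) (0, 0) := by
    intro x y z hz h
    exact (CellJoined.vertical x y z h).trans
      ((CellJoined.horizontal z x 0 fun w _ _ => outside w z (Or.inr hz)).trans
      (CellJoined.vertical 0 z 0 fun w _ _ => outside 0 w (Or.inl (by omega))))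
  refine CellJoined.connected (0, 0) (outside 0 0 (by omega)) fun a ha => ?_
  obtain ⟨x, y⟩ := a
  have hxy : (x, y) ∉ P := ha
  by_cases hy : y < L x
  · refine key x y (min y (-N)) (by omega) fun w h₁ h₂ h₃ => ?_
    have := (hP.mem x w).1 h₃
    omega
  · refine key x y (max y N) (by omega) fun w h₁ h₂ h₃ => ?_
    have := (hP.mem x w).1 h₃
    rw [hP.mem] at hxy
    omega

/-- The vertices of a strip lie at the ends of its columns. -/
theorem ordinate_of_isVertex (hP : IsStrip P n L U) {x y : ℤ} (hv : IsVertex P (x, y)) :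
    (1 ≤ x ∧ x < n ∧ (y = L x ∨ y = U x)) ∨
    (2 ≤ x ∧ x ≤ n ∧ (y = L (x - 1) ∨ y = U (x - 1))) := by
  have h := hv.2
  have h₁ := hP.lt x
  have h₂ := hP.lt (x - 1)
  simp only [IsHorizontalBoundaryEdge, Xor, hP.mem] at h
  omega

end IsStrip

/-! ### Column convex polyominoes are strips -/

/-- A connected set of cells meeting both a set of cells and its complement contains an adjacent
pair of cells separated by that set. -/
theorem IsPolyomino.exists_adj {P : Finset (ℤ × ℤ)} (hP : IsPolyomino P) (p : ℤ × ℤ → Prop)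
    {a b : ℤ × ℤ} (ha : a ∈ P) (hb : b ∈ P) (hpa : p a) (hpb : ¬ p b) :
    ∃ u ∈ P, ∃ v ∈ P, cellGraph.Adj u v ∧ p u ∧ ¬ p v := by
  obtain ⟨w⟩ := hP.preconnected ⟨a, ha⟩ ⟨b, hb⟩
  obtain ⟨d, -, h₁, h₂⟩ := w.exists_boundary_dart {c | p c} hpa hpb
  exact ⟨d.fst, d.fst.2, d.snd, d.snd.2, d.adj, h₁, h₂⟩

theorem exists_isStrip {P : Finset (ℤ × ℤ)} {n : ℕ} (hP : IsPolyomino P) (hc : IsColumnConvex P)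
    (hpl : IsPlaced P) (hn : (P.image Prod.fst).card + 1 = n) : ∃ L U, IsStrip P n L U := by
  obtain ⟨hpos, ⟨c, hcP, hc1⟩, -⟩ := hpl
  have cross : ∀ x z w : ℤ, 1 ≤ x → x < z → (z, w) ∈ P → ∃ y, (x, y) ∈ P ∧ (x + 1, y) ∈ P := by
    intro x z w hx hz hzP
    -- An edge leaving the half-plane of columns up to `x` joins columns `x` and `x + 1` in one row.
    obtain ⟨⟨u₁, u₂⟩, hu, ⟨v₁, v₂⟩, hv, huv, h₁, h₂⟩ :=
      hP.exists_adj (fun c => c.1 ≤ x) hcP hzP (by omega) (by simp only; omega)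
    simp only [cellGraph] at huv h₁ h₂
    obtain ⟨rfl, rfl, rfl⟩ : u₁ = x ∧ v₁ = x + 1 ∧ v₂ = u₂ := by
      rcases abs_cases (u₁ - v₁) with h | h <;> rcases abs_cases (u₂ - v₂) with h' | h' <;> omega
    exact ⟨_, hu, hv⟩
  have hne : (P.image Prod.fst).Nonempty := ⟨_, Finset.mem_image_of_mem _ hcP⟩
  set m := (P.image Prod.fst).max' hne with hm
  obtain ⟨⟨m₁, m₂⟩, hmP, hm₁⟩ := Finset.mem_image.1 ((P.image Prod.fst).max'_mem hne)
  have hm₁ : m₁ = m := hm₁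
  subst hm₁
  have hle : ∀ x y, (x, y) ∈ P → 1 ≤ x ∧ x ≤ m := fun x y h =>
    ⟨(hpos _ h).1, Finset.le_max' _ _ (Finset.mem_image_of_mem Prod.fst h)⟩
  have himage : P.image Prod.fst = Finset.Icc 1 m := by
    ext x
    simp only [Finset.mem_image, Finset.mem_Icc]
    constructor
    · rintro ⟨⟨a, b⟩, h, rfl⟩
      exact hle a b h
    · rintro ⟨h₁, h₂⟩
      rcases h₂.lt_or_eq with h₂ | rfl
      · obtain ⟨y, hy, -⟩ := cross x m m₂ h₁ h₂ hmP
        exact ⟨_, hy, rfl⟩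
      · exact ⟨_, hmP, rfl⟩
  have hmn : m + 1 = n := by
    rw [himage, Int.card_Icc] at hn
    have := (hle _ _ hmP).1
    omega
  have column : ∀ x : ℤ, ∃ l u : ℤ, 1 ≤ x → x < n → l < u ∧ ∀ y, (x, y) ∈ P ↔ l ≤ y ∧ y < u := by
    intro x
    by_cases hx : 1 ≤ x ∧ x < n
    swap
    -- Outside the columns of `P` the values of `L` and `U` are irrelevant.
    · exact ⟨0, 0, fun h₁ h₂ => absurd ⟨h₁, h₂⟩ hx⟩
    set Y := (P.filter fun c => c.1 = x).image Prod.snd with hY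
    have mem : ∀ y, y ∈ Y ↔ (x, y) ∈ P := by
      intro y
      simp only [hY, Finset.mem_image, Finset.mem_filter]
      constructor
      · rintro ⟨⟨a, b⟩, ⟨h, rfl⟩, rfl⟩
        exact h
      · exact fun h => ⟨_, ⟨h, rfl⟩, rfl⟩
    have hYne : Y.Nonempty := by
      have : x ∈ P.image Prod.fst := by rw [himage, Finset.mem_Icc]; omega
      obtain ⟨⟨a, b⟩, h, rfl⟩ := Finset.mem_image.1 this
      exact ⟨b, (mem b).2 h⟩
    have hmin := Y.min'_mem hYne
    have hmax := Y.max'_mem hYne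
    refine ⟨Y.min' hYne, Y.max' hYne + 1, fun _ _ => ⟨?_, fun y => ⟨fun h => ?_, fun h => ?_⟩⟩⟩
    · have := Y.min'_le _ hmax
      omega
    · have h₁ := Y.min'_le _ ((mem y).2 h)
      have h₂ := Y.le_max' _ ((mem y).2 h)
      omega
    · exact hc x _ y _ h.1 (by omega) ((mem _).1 hmin) ((mem _).1 hmax)
  choose L U hLU using column
  have hadj : ∀ x : ℤ, 1 ≤ x → x + 1 < n → L x < U (x + 1) ∧ L (x + 1) < U x := by
    intro x h₁ h₂
    obtain ⟨y, hy, hy'⟩ := cross x m m₂ h₁ (by omega) hmP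
    rw [(hLU x h₁ (by omega)).2] at hy
    rw [(hLU (x + 1) (by omega) h₂).2] at hy'
    omega
  refine ⟨L, U, ?_, fun x y => ⟨fun h => ?_, fun h => ?_⟩, fun x h₁ h₂ => (hLU x h₁ h₂).1,
    fun x h₁ h₂ => (hadj x h₁ h₂).1, fun x h₁ h₂ => (hadj x h₁ h₂).2⟩
  · have := (hle _ _ hmP).1
    omega
  · have h' := hle x y h
    have hx : x < n := by omega
    exact ⟨h'.1, hx, ((hLU x h'.1 hx).2 y).1 h⟩
  · exact ((hLU x h.1 h.2.1).2 y).2 h.2.2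

/-! ### Row convexity and vertices of a strip -/

namespace IsStrip

variable {P : Finset (ℤ × ℤ)} {n : ℤ} {L U : ℤ → ℤ}

/-- Columns that all miss the row `y` lie on the same side of it. -/
theorem same_side (hP : IsStrip P n L U) {a b y : ℤ} (ha : 1 ≤ a) (hab : a ≤ b) :
    b < n → (∀ x, a ≤ x → x ≤ b → ¬ (L x ≤ y ∧ y < U x)) → (U a ≤ y ↔ U b ≤ y) := by
  induction b, hab using Int.leInduction with
  | base => exact fun _ _ => Iff.rfl
  | succ b hb ih =>
    intro hn h
    -- Columns `b` and `b + 1` share a row, so they cannot lie strictly on opposite sides of row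
    -- `y`.
    have h₁ := h b hb (by omega)
    have h₂ := h (b + 1) (by omega) le_rfl
    have h₃ := hP.lt_succ b (by omega) hn
    have h₄ := hP.succ_lt b (by omega) hn
    have h₅ := hP.lt b (by omega) (by omega)
    have h₆ := hP.lt (b + 1) (by omega) (by omega)
    have := ih (by omega) fun x h₁ h₂ => h x h₁ (by omega)
    omega

theorem exists_column (hP : IsStrip P n L U) {a b y : ℤ} (ha : 1 ≤ a) (hab : a ≤ b) (hb : b < n)
    (h : ¬ (U a ≤ y ↔ U b ≤ y)) : ∃ x, a ≤ x ∧ x ≤ b ∧ (x, y) ∈ P := by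
  by_contra hcon
  refine h (hP.same_side ha hab hb fun x h₁ h₂ h₃ => hcon ⟨x, h₁, h₂, ?_⟩)
  rw [hP.mem]
  omega

/-- Otherwise the row just below column `b` meets `P` on both sides of `b`: in column `a` itself,
or, if that column is too low, in some column on the way to `b`; likewise for `c`. Row convexity
then adds a cell below column `b`. -/
theorem lower_le_max (hP : IsStrip P n L U) (hr : IsRowConvex P) {a b c : ℤ} (ha : 1 ≤ a)
    (hab : a ≤ b) (hbc : b ≤ c) (hc : c < n) : L b ≤ max (L a) (L c) := by
  by_contra hcon
  have hUa := hP.lt a ha (by omega)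
  have hUb := hP.lt b (by omega) (by omega)
  have hUc := hP.lt c (by omega) (by omega)
  have left : ∃ x, x ≤ b ∧ (x, L b - 1) ∈ P := by
    by_cases h : U a ≤ L b - 1
    · obtain ⟨x, -, h₂, h₃⟩ := hP.exists_column (y := L b - 1) ha hab (by omega) (by omega)
      exact ⟨x, h₂, h₃⟩
    · exact ⟨a, hab, by rw [hP.mem]; omega⟩
  have right : ∃ x, b ≤ x ∧ (x, L b - 1) ∈ P := by
    by_cases h : U c ≤ L b - 1
    · obtain ⟨x, h₂, -, h₃⟩ :=
        hP.exists_column (y := L b - 1) (by omega) hbc (by omega) (by omega)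
      exact ⟨x, h₂, h₃⟩
    · exact ⟨c, hbc, by rw [hP.mem]; omega⟩
  obtain ⟨x, hx, hx'⟩ := left
  obtain ⟨z, hz, hz'⟩ := right
  have := (hP.mem _ _).1 (hr _ x b z hx hz hx' hz')
  omega

theorem min_le_upper (hP : IsStrip P n L U) (hr : IsRowConvex P) {a b c : ℤ} (ha : 1 ≤ a)
    (hab : a ≤ b) (hbc : b ≤ c) (hc : c < n) : min (U a) (U c) ≤ U b := by
  by_contra hcon
  obtain ⟨x, -, hx, hx'⟩ := hP.exists_column (y := U b) ha hab (by omega) (by omega)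
  obtain ⟨z, hz, -, hz'⟩ :=
    hP.exists_column (y := U b) (by omega) hbc (by omega) (by omega)
  have := (hP.mem _ _).1 (hr _ x b z hx hz hx' hz')
  omega

/-- A vertex at which a vertical clockwise side starts. -/
theorem ordinate_of_vertical_side (hP : IsStrip P n L U) {x y z : ℤ} (hv : IsVertex P (x, y))
    (hs : IsClockwiseSide P (x, y) (x, z)) :
    (1 ≤ x ∧ x < n ∧ y = L x) ∨
    (2 ≤ x ∧ x ≤ n ∧ y = U (x - 1) ∧ (x = n ∨ U (x - 1) ≠ U x)) := by
  have hv := hP.ordinate_of_isVertex hv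
  have h₁ := hP.lt x
  have h₂ := hP.lt (x - 1)
  have h₃ := hP.lt_pred x
  have h₄ := hP.pred_lt x
  rcases hs with ⟨-, h, hs⟩ | ⟨-, h, hs⟩ | ⟨-, h, hs⟩ | ⟨-, h, hs⟩ <;> simp only at h hs
  · have := hs y le_rfl h
    simp only [hP.mem] at this
    omega
  · omega
  · have := hs (y - 1) (by omega) (by omega)
    simp only [hP.mem] at this
    omega
  · omega

theorem isVertex_first (hP : IsStrip P n L U) : IsVertex P (1, L 1) := by
  have h₁ := hP.lt 1 le_rfl (by have := hP.two_le; omega)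
  have h₂ := hP.two_le
  constructor
  · left
    simp only [IsVerticalBoundaryEdge, Xor, hP.mem]
    omega
  · left
    simp only [IsHorizontalBoundaryEdge, Xor, hP.mem]
    omega

end IsStrip

/-! ### From a convex permutomino to a lower unimodal sublist -/

theorem Represents.eq_of_fst_eq {n : ℕ} {S : Set (ℤ × ℤ)} {π : Equiv.Perm (Fin n)}
    (h : Represents S π) {v w : ℤ × ℤ} (hv : v ∈ S) (hw : w ∈ S) (he : v.1 = w.1) : v = w := by
  rw [h] at hv hw
  obtain ⟨i, rfl⟩ := hv
  obtain ⟨j, rfl⟩ := hw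
  obtain rfl : i = j := by
    simp only at he
    omega
  rfl

theorem Represents.eq_of_snd_eq {n : ℕ} {S : Set (ℤ × ℤ)} {π : Equiv.Perm (Fin n)}
    (h : Represents S π) {v w : ℤ × ℤ} (hv : v ∈ S) (hw : w ∈ S) (he : v.2 = w.2) : v = w := by
  rw [h] at hv hw
  obtain ⟨i, rfl⟩ := hv
  obtain ⟨j, rfl⟩ := hw
  obtain rfl : i = j := π.injective (by
    simp only at he
    omega)
  rfl

theorem IsClockwiseSide.fst_eq_or_snd_eq {P : Finset (ℤ × ℤ)} {v w : ℤ × ℤ}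
    (h : IsClockwiseSide P v w) : v.1 = w.1 ∨ v.2 = w.2 := by
  rcases h with h | h | h | h <;> simp [h.1]

/-- Along the boundary, the sides starting at odd vertices are vertical. -/
theorem IsClockwiseVertexList.fst_eq {P : Finset (ℤ × ℤ)} {n : ℕ} {L U : ℤ → ℤ}
    (hP : IsStrip P n L U) {r : ℕ} {A : ℕ → ℤ × ℤ} (hA : IsClockwiseVertexList P r A)
    {π₁ π₂ : Equiv.Perm (Fin n)} (h₁ : Represents {v | ∃ k ≤ r, v = A (2 * k + 1)} π₁)
    (h₂ : Represents {v | ∃ k ≤ r, v = A (2 * k + 2)} π₂) :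
    ∀ k ≤ r, (A (2 * k + 1)).1 = (A (2 * k + 2)).1 := by
  have isVertex : ∀ i, 1 ≤ i → i ≤ 2 * (r + 1) → IsVertex P (A i) := fun i h h' =>
    hA.image_eq.subset ⟨i, ⟨h, h'⟩, rfl⟩
  have first : A 1 = (1, L 1) := by
    have hv := isVertex 1 le_rfl (by omega)
    have hs := hA.start _ hP.isVertex_first
    have ho := hP.ordinate_of_isVertex (x := (A 1).1) (y := (A 1).2) hv
    have := hP.lt 1
    have hx : (A 1).1 = 1 := by omega
    rw [hx] at ho
    ext
    · exact hx
    · simp only at hs ⊢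
      omega
  intro k
  induction k with
  | zero =>
    intro _
    have hs := hA.side 1 le_rfl (by omega)
    rw [first] at hs
    simp only [mul_zero, zero_add]
    rw [first]
    -- Going east would need a cell below column `1`, going west a cell in a column before it.
    rcases hs with h | ⟨-, h, h'⟩ | h | ⟨-, h, h'⟩
    · exact h.1
    · have := h' 1 le_rfl h
      simp only [hP.mem] at this
      omega
    · exact h.1
    · have := h' _ le_rfl h
      simp only [hP.mem] at this h
      omega
  | succ k ih =>
    intro hk
    have ih := ih (by omega)
    have hs := (hA.side (2 * k + 2) (by omega) (by omega)).fst_eq_or_snd_eq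
    have hs' := (hA.side (2 * k + 3) (by omega) (by omega)).fst_eq_or_snd_eq
    have horizontal : (A (2 * k + 2)).2 = (A (2 * k + 3)).2 := by
      refine hs.resolve_left fun h => ?_
      have := hA.injOn ⟨by omega, by omega⟩ ⟨by omega, by omega⟩
        (h₁.eq_of_fst_eq ⟨k, by omega, rfl⟩ ⟨k + 1, hk, rfl⟩ (ih.trans h))
      omega
    refine hs'.resolve_right fun h => ?_
    have := hA.injOn ⟨by omega, by omega⟩ ⟨by omega, by omega⟩
      (h₂.eq_of_snd_eq ⟨k, by omega, rfl⟩ ⟨k + 1, hk, rfl⟩ (horizontal.trans h))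
    omega

/-- The ordinates of the first permutation of a permutomino. -/
theorem Permutomino.perm₁_ordinate {n : ℕ} (Q : Permutomino n) {L U : ℤ → ℤ}
    (hQ : IsStrip Q.cells n L U) (i : Fin n) :
    ((i : ℤ) + 1 < n ∧ (Q.perm₁ i : ℤ) + 1 = L (i + 1)) ∨
    (1 ≤ (i : ℤ) ∧ (Q.perm₁ i : ℤ) + 1 = U i ∧ ((i : ℤ) + 1 = n ∨ U i ≠ U (i + 1))) := by
  obtain ⟨r, A, hA, h₁, h₂⟩ := Q.represents
  have hi : (((i : ℕ) : ℤ) + 1, ((Q.perm₁ i : ℕ) : ℤ) + 1) ∈ {v | ∃ k ≤ r, v = A (2 * k + 1)} := by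
    rw [h₁]
    exact ⟨i, rfl⟩
  obtain ⟨k, hk, hi⟩ := hi
  have hv : IsVertex Q.cells (A (2 * k + 1)) :=
    hA.image_eq.subset ⟨2 * k + 1, ⟨by omega, by omega⟩, rfl⟩
  have hs := hA.side (2 * k + 1) (by omega) (by omega)
  have hx := IsClockwiseVertexList.fst_eq hQ hA h₁ h₂ k hk
  have hw : A (2 * k + 1 + 1) = ((i : ℤ) + 1, (A (2 * k + 1 + 1)).2) := by
    ext
    · exact hx.symm.trans (by rw [← hi])
    · rfl
  rw [hw, ← hi] at hs
  rw [← hi] at hv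
  have := hQ.ordinate_of_vertical_side hv hs
  rw [add_sub_cancel_right] at this
  omega

theorem Permutomino.IsConvex.isLowerUnimodalOn {n : ℕ} {Q : Permutomino n} (hQ : Q.IsConvex) :
    IsLowerUnimodalOn Q.perm₁ (sigmaPositions Q.perm₁) := by
  obtain ⟨L, U, hS⟩ := exists_isStrip Q.isPolyomino hQ.1 Q.isPlaced Q.card_columns
  have hn := hS.two_le
  set π := Q.perm₁ with hπ
  have ordinate := Q.perm₁_ordinate hS
  simp only [← hπ] at ordinate
  have ne : ∀ i j : Fin n, i ≠ j → (π i : ℕ) ≠ π j := fun i j h h' => h (π.injective (Fin.ext h'))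
  have mem_mu : ∀ i : Fin n, 1 ≤ (i : ℤ) → (π i : ℤ) + 1 = U i → U i ≠ U (i + 1) →
      (i : ℤ) + 1 < n → i ∈ muPositions π := by
    intro i hi hiU hne hin
    -- Where `U` increases, it has only increased before, so every earlier entry is smaller; where
    -- it decreases, every later one is.
    rcases hne.lt_or_gt with hlt | hlt
    · left
      intro j hj
      have hne := ne j i hj.ne
      rw [Fin.lt_def] at hj ⊢
      rcases ordinate j with h | h
      · have h₁ := hS.lt (j + 1) (by omega) (by omega)
        have h₂ := hS.min_le_upper hQ.2 (a := j + 1) (b := i) (c := i + 1) (by omega) (by omega)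
          (by omega) (by omega)
        omega
      · have h₂ := hS.min_le_upper hQ.2 (a := j) (b := i) (c := i + 1) (by omega) (by omega)
          (by omega) (by omega)
        omega
    · right
      intro j hj
      rw [Fin.lt_def] at hj ⊢
      rcases ordinate j with h | h
      · have h₁ := hS.lt (j + 1) (by omega) (by omega)
        have h₂ := hS.min_le_upper hQ.2 (a := i) (b := i + 1) (c := j + 1) (by omega) (by omega)
          (by omega) (by omega)
        omega
      · have h₂ := hS.min_le_upper hQ.2 (a := i) (b := i + 1) (c := j) (by omega) (by omega)
          (by omega) (by omega)
        omega
  have sigma : ∀ i ∈ sigmaPositions π, ((i : ℤ) + 1 < n ∧ (π i : ℤ) + 1 = L (i + 1)) ∨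
      ((i : ℤ) + 1 = n ∧ (π i : ℤ) + 1 = U i) := by
    intro i hi
    rcases ordinate i with h | ⟨h₁, h₂, h₃⟩
    · exact Or.inl h
    · by_cases h₄ : (i : ℤ) + 1 = n
      · exact Or.inr ⟨h₄, h₂⟩
      · rcases hi with hi | hi | hi
        · omega
        · omega
        · exact absurd (mem_mu i h₁ h₂ (h₃.resolve_left h₄) (by omega)) hi
  have lower_pos : ∀ x : ℤ, 1 ≤ x → x < n → 1 ≤ L x := fun x h₁ h₂ =>
    (Q.isPlaced.1 _ ((hS.mem x (L x)).2 ⟨h₁, h₂, le_rfl, hS.lt x h₁ h₂⟩)).2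
  have hn0 : 0 < n := by omega
  -- The turning point is the position of the least entry, where the lower boundary touches height
  -- `1`.
  obtain ⟨k, hk⟩ := π.surjective ⟨0, hn0⟩
  have hk0 : (π k : ℕ) = 0 := by rw [hk]
  have hkL : (k : ℤ) + 1 < n ∧ L (k + 1) = 1 := by
    rcases ordinate k with h | ⟨h₁, h₂, -⟩
    · omega
    · have := lower_pos k (by omega) (by omega)
      have := hS.lt k (by omega) (by omega)
      omega
  have hkσ : k ∈ sigmaPositions π := by
    by_cases h0 : (k : ℕ) = 0
    · exact Or.inl h0
    · refine Or.inr (Or.inr ?_)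
      rintro (h | h)
      · have := h ⟨0, hn0⟩ (by rw [Fin.lt_def]; simp only; omega)
        rw [Fin.lt_def] at this
        omega
      · have := h ⟨n - 1, by omega⟩ (by rw [Fin.lt_def]; simp only; omega)
        rw [Fin.lt_def] at this
        omega
  refine ⟨k, hkσ, ?_, ?_⟩
  · rintro i ⟨hi, hik⟩ j ⟨hj, hjk⟩ hij
    have hne := ne i j hij.ne
    rw [Fin.lt_def] at *
    rw [Fin.le_def] at *
    have hi := sigma i hi
    have hj := sigma j hj
    have := lower_pos (i + 1) (by omega) (by omega)
    have := hS.lower_le_max hQ.2 (a := i + 1) (b := j + 1) (c := k + 1) (by omega) (by omega)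
      (by omega) (by omega)
    omega
  · rintro i ⟨hi, hik⟩ j ⟨hj, hjk⟩ hij
    have hne := ne i j hij.ne
    rw [Fin.lt_def] at *
    rw [Fin.le_def] at *
    have hi := sigma i hi
    have hj := sigma j hj
    have := lower_pos (i + 1) (by omega) (by omega)
    rcases hj with hj | hj
    · have := hS.lower_le_max hQ.2 (a := k + 1) (b := i + 1) (c := j + 1) (by omega) (by omega)
        (by omega) (by omega)
      omega
    -- The last entry is `U (n - 1)`, which exceeds `L (n - 1)`.
    · have := hS.lower_le_max hQ.2 (a := k + 1) (b := i + 1) (c := j) (by omega) (by omega)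
        (by omega) (by omega)
      have := lower_pos j (by omega) (by omega)
      have := hS.lt j (by omega) (by omega)
      omega

/-! ### The cyclic order of the positions -/

theorem first_mem_mu {n : ℕ} (π : Equiv.Perm (Fin n)) {i : Fin n} (hi : (i : ℕ) = 0) :
    i ∈ muPositions π :=
  Or.inl fun j hj => by rw [Fin.lt_def] at hj; omega

theorem last_mem_mu {n : ℕ} (π : Equiv.Perm (Fin n)) {i : Fin n} (hi : (i : ℕ) + 1 = n) :
    i ∈ muPositions π :=
  Or.inr fun j hj => by rw [Fin.lt_def] at hj; omega

/-- `j` follows `i` in the cyclic order of the positions that runs forwards through `M` and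
backwards through `S`. -/
def CyclicStep {n : ℕ} (M S : Set (Fin n)) (i j : Fin n) : Prop :=
  (i ∈ M ∧ j ∈ M ∧ i < j ∧ ∀ t ∈ M, i < t → j ≤ t) ∨
  (i ∈ S ∧ j ∈ S ∧ j < i ∧ ∀ t ∈ S, t < i → t ≤ j)

open Classical in
/-- A key ordering the positions in `μ(π)` forwards and then the other ones backwards. -/
noncomputable def cyclicKey {n : ℕ} (π : Equiv.Perm (Fin n)) (i : Fin n) : ℕ :=
  if i ∈ muPositions π then i else 2 * n - i

theorem cyclicKey_spec {n : ℕ} (π : Equiv.Perm (Fin n)) (i : Fin n) :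
    (i ∈ muPositions π ∧ cyclicKey π i = i) ∨
    (i ∉ muPositions π ∧ cyclicKey π i = 2 * n - i) := by
  by_cases h : i ∈ muPositions π <;> simp [cyclicKey, h]

theorem cyclicKey_injective {n : ℕ} (π : Equiv.Perm (Fin n)) :
    Function.Injective (cyclicKey π) := by
  intro i j h
  have hi := cyclicKey_spec π i
  have hj := cyclicKey_spec π j
  omega

theorem cyclicStep_of_consecutive {n : ℕ} (π : Equiv.Perm (Fin n)) {i j : Fin n}
    (hij : cyclicKey π i < cyclicKey π j)
    (h : ∀ t, cyclicKey π t ≤ cyclicKey π i ∨ cyclicKey π j ≤ cyclicKey π t) :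
    CyclicStep (muPositions π) (sigmaPositions π) i j := by
  have hn : n - 1 < n := by have := i.2; omega
  have hlast := h ⟨n - 1, hn⟩
  have hl : cyclicKey π ⟨n - 1, hn⟩ = n - 1 := by
    have := last_mem_mu π (i := ⟨n - 1, hn⟩) (by simp only; omega)
    simp [cyclicKey, this]
  have hj := cyclicKey_spec π j
  rcases cyclicKey_spec π i with ⟨hi, hi'⟩ | ⟨hi, hi'⟩
  · by_cases hin : (i : ℕ) + 1 = n
    -- The last position is in both `μ(π)` and `σ(π)`: here the order turns back.
    · have hjμ : j ∉ muPositions π := fun h' => by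
        have := hj.resolve_right fun h => h.1 h'
        omega
      refine Or.inr ⟨Or.inr (Or.inl hin), Or.inr (Or.inr hjμ), ?_, fun t ht hti => ?_⟩
      · rw [Fin.lt_def]
        have : j ≠ i := fun h' => hjμ (h' ▸ hi)
        omega
      · rw [Fin.le_def]
        rw [Fin.lt_def] at hti
        have hj := hj.resolve_left fun h => hjμ h.1
        rcases ht with ht | ht | ht
        · omega
        · omega
        · have := h t
          have := (cyclicKey_spec π t).resolve_left fun h => ht h.1
          omega
    · have hj : j ∈ muPositions π ∧ cyclicKey π j = j := hj.resolve_right fun h' => by omega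
      refine Or.inl ⟨hi, hj.1, by rw [Fin.lt_def]; omega, fun t ht hit => ?_⟩
      rw [Fin.le_def]
      rw [Fin.lt_def] at hit
      have := h t
      have := (cyclicKey_spec π t).resolve_right fun h => h.1 ht
      omega
  · have hj : j ∉ muPositions π ∧ cyclicKey π j = 2 * n - j := hj.resolve_left fun h' => by omega
    refine Or.inr ⟨Or.inr (Or.inr hi), Or.inr (Or.inr hj.1), by rw [Fin.lt_def]; omega,
      fun t ht hti => ?_⟩
    rw [Fin.le_def]
    rw [Fin.lt_def] at hti
    rcases ht with ht | ht | ht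
    · omega
    · omega
    · have := h t
      have := (cyclicKey_spec π t).resolve_left fun h => ht h.1
      omega

theorem eq_first_of_cyclicKey_le {n : ℕ} (π : Equiv.Perm (Fin n)) {j : Fin n}
    (hj : ∀ t, cyclicKey π j ≤ cyclicKey π t) : (j : ℕ) = 0 := by
  have hn : 0 < n := by have := j.2; omega
  have := hj ⟨0, hn⟩
  have h0 : cyclicKey π ⟨0, hn⟩ = 0 := by
    have := first_mem_mu π (i := ⟨0, hn⟩) rfl
    simp [cyclicKey, this]
  have := cyclicKey_spec π j
  omega

theorem cyclicStep_of_last {n : ℕ} (hn : 2 ≤ n) (π : Equiv.Perm (Fin n)) {i j : Fin n}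
    (hi : ∀ t, cyclicKey π t ≤ cyclicKey π i) (hj : ∀ t, cyclicKey π j ≤ cyclicKey π t) :
    CyclicStep (muPositions π) (sigmaPositions π) i j := by
  have hj0 := eq_first_of_cyclicKey_le π hj
  have hl : cyclicKey π ⟨n - 1, by omega⟩ = n - 1 := by
    have := last_mem_mu π (i := ⟨n - 1, by omega⟩) (by simp only; omega)
    simp [cyclicKey, this]
  have hlast := hi ⟨n - 1, by omega⟩
  have hs := cyclicKey_spec π i
  refine Or.inr ⟨?_, Or.inl hj0, ?_, fun t ht hti => ?_⟩
  · by_cases h : i ∈ muPositions π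
    · have := hs.resolve_right fun h' => h'.1 h
      exact Or.inr (Or.inl (by omega))
    · exact Or.inr (Or.inr h)
  · rw [Fin.lt_def]
    by_contra hcon
    have := first_mem_mu π (i := i) (by omega)
    have := hs.resolve_right fun h' => h'.1 this
    omega
  · rw [Fin.le_def]
    rw [Fin.lt_def] at hti
    have := hi t
    rcases ht with ht | ht | ht
    · omega
    · omega
    · have := (cyclicKey_spec π t).resolve_left fun h => ht h.1
      omega

/-- The positions of `π`, cyclically ordered. -/
theorem exists_cyclic_order {n : ℕ} (hn : 2 ≤ n) (π : Equiv.Perm (Fin n)) :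
    ∃ (s : Equiv.Perm (Fin n)) (c : ℕ → Fin n), (c 0 : ℕ) = 0 ∧ c n = c 0 ∧
      (∀ k < n, ∀ l < n, c k = c l → k = l) ∧ (∀ i, ∃ k < n, c k = i) ∧
      (∀ k < n, c (k + 1) = s (c k)) ∧
      ∀ i, CyclicStep (muPositions π) (sigmaPositions π) i (s i) := by
  obtain ⟨m, rfl⟩ : ∃ m, n = m + 1 := ⟨n - 1, by omega⟩
  set e := Tuple.sort (cyclicKey π) with he
  have hmono : Monotone (cyclicKey π ∘ e) := Tuple.monotone_sort _
  have hstrict : StrictMono (cyclicKey π ∘ e) :=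
    hmono.strictMono_of_injective ((cyclicKey_injective π).comp e.injective)
  have min : ∀ t, cyclicKey π (e 0) ≤ cyclicKey π t := fun t => by
    simpa using hmono (Fin.zero_le (e.symm t))
  have max : ∀ t, cyclicKey π t ≤ cyclicKey π (e (Fin.last m)) := fun t => by
    simpa using hmono (Fin.le_last (e.symm t))
  -- The successor is the rotation of the positions sorted by key.
  refine ⟨e.symm.trans ((finRotate (m + 1)).trans e), fun k => e (Fin.ofNat (m + 1) k), ?_, ?_,
    ?_, ?_, ?_, ?_⟩
  · exact eq_first_of_cyclicKey_le π min
  · exact congrArg e (Fin.ext (by simp))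
  · intro k hk l hl h
    have := congrArg Fin.val (e.injective h)
    simpa [Nat.mod_eq_of_lt hk, Nat.mod_eq_of_lt hl] using this
  · intro i
    exact ⟨e.symm i, (e.symm i).2, by simp⟩
  · intro k _
    simp only [Equiv.trans_apply, Equiv.symm_apply_apply, finRotate_apply]
    congr 1
    ext
    simp [Fin.val_add]
  · intro i
    obtain ⟨k, rfl⟩ := e.surjective i
    simp only [Equiv.trans_apply, Equiv.symm_apply_apply]
    by_cases hk : k = Fin.last m
    · subst hk
      rw [finRotate_last]
      exact cyclicStep_of_last hn π max min
    · have hv := coe_finRotate_of_ne_last hk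
      refine cyclicStep_of_consecutive π (hstrict ?_) fun t => ?_
      · rw [Fin.lt_def]
        omega
      · obtain ⟨l, rfl⟩ := e.surjective t
        rcases le_or_gt l k with h | h
        · exact Or.inl (hmono h)
        · refine Or.inr (hmono ?_)
          rw [Fin.le_def]
          rw [Fin.lt_def] at h
          omega

/-! ### The boundary of a strip, side by side -/

/-- The boundary of a strip at the abscissa `x` is the segment from `(x, a)` to `(x, b)`, and it
goes on horizontally to the point `(x', b)`. -/
def IsBoundaryStep (n : ℤ) (L U : ℤ → ℤ) (x x' a b : ℤ) : Prop :=
  (1 ≤ x ∧ x < x' ∧ x' ≤ n ∧ (∀ z, x ≤ z → z < x' → U z = b) ∧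
    ((x = 1 ∧ L x = a) ∨ (2 ≤ x ∧ U (x - 1) = a ∧ L (x - 1) = L x))) ∨
  (1 ≤ x' ∧ x' < x ∧ x ≤ n ∧ (∀ z, x' ≤ z → z < x → L z = b) ∧
    ((x = n ∧ U (x - 1) = a) ∨ (x < n ∧ L x = a ∧ U (x - 1) = U x)))

namespace IsStrip

variable {P : Finset (ℤ × ℤ)} {n : ℤ} {L U : ℤ → ℤ} {x x' a b : ℤ}

theorem vertical_side (hP : IsStrip P n L U) (h : IsBoundaryStep n L U x x' a b) (hab : a ≠ b) :
    IsClockwiseSide P (x, a) (x, b) := by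
  have h₁ := hP.lt x
  have h₂ := hP.lt (x - 1)
  have h₃ := hP.lt_pred x
  have h₄ := hP.pred_lt x
  have h₅ : (x < x' → U x = b) ∧ (x' < x → L (x - 1) = b) := by
    rcases h with ⟨-, h, -, h', -⟩ | ⟨-, h, -, h', -⟩
    · exact ⟨fun _ => h' x le_rfl h, fun _ => by omega⟩
    · exact ⟨fun _ => by omega, fun _ => h' (x - 1) (by omega) (by omega)⟩
  have h : (1 ≤ x ∧ x < x' ∧ x' ≤ n ∧
    ((x = 1 ∧ L x = a) ∨ (2 ≤ x ∧ U (x - 1) = a ∧ L (x - 1) = L x))) ∨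
    (1 ≤ x' ∧ x' < x ∧ x ≤ n ∧
    ((x = n ∧ U (x - 1) = a) ∨ (x < n ∧ L x = a ∧ U (x - 1) = U x))) := by
    rcases h with ⟨h₁, h₂, h₃, -, h⟩ | ⟨h₁, h₂, h₃, -, h⟩
    · exact Or.inl ⟨h₁, h₂, h₃, h⟩
    · exact Or.inr ⟨h₁, h₂, h₃, h⟩
  rcases hab.lt_or_gt with hab | hab
  · refine Or.inl ⟨rfl, hab, fun y hy hy' => ?_⟩
    simp only at hy hy'
    simp only [hP.mem]
    omega
  · refine Or.inr (Or.inr (Or.inl ⟨rfl, hab, fun y hy hy' => ?_⟩))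
    simp only at hy hy'
    simp only [hP.mem]
    omega

theorem horizontal_side (hP : IsStrip P n L U) (h : IsBoundaryStep n L U x x' a b) :
    IsClockwiseSide P (x, b) (x', b) := by
  rcases h with ⟨h₁, h₂, h₃, h, -⟩ | ⟨h₁, h₂, h₃, h, -⟩
  · refine Or.inr (Or.inl ⟨rfl, h₂, fun z hz hz' => ?_⟩)
    have := h z hz hz'
    have := hP.lt z
    simp only at hz hz'
    simp only [hP.mem]
    omega
  · refine Or.inr (Or.inr (Or.inr ⟨rfl, h₂, fun z hz hz' => ?_⟩))
    have := h z hz hz'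
    have := hP.lt z
    simp only at hz hz'
    simp only [hP.mem]
    omega

theorem isVertex_iff (hP : IsStrip P n L U) (h : IsBoundaryStep n L U x x' a b) (hab : a ≠ b)
    {y : ℤ} : IsVertex P (x, y) ↔ y = a ∨ y = b := by
  have h₁ := hP.lt x
  have h₂ := hP.lt (x - 1)
  have h₃ := hP.lt_pred x
  have h₄ := hP.pred_lt x
  have h₅ : (x < x' → U x = b) ∧ (x' < x → L (x - 1) = b) := by
    rcases h with ⟨-, h, -, h', -⟩ | ⟨-, h, -, h', -⟩
    · exact ⟨fun _ => h' x le_rfl h, fun _ => by omega⟩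
    · exact ⟨fun _ => by omega, fun _ => h' (x - 1) (by omega) (by omega)⟩
  simp only [IsVertex, IsVerticalBoundaryEdge, IsHorizontalBoundaryEdge, Xor, hP.mem]
  rcases h with ⟨h₆, h₇, h₈, -, h | h⟩ | ⟨h₆, h₇, h₈, -, h | h⟩
  · constructor
    · omega
    · rintro (rfl | rfl) <;> omega
  · constructor
    · omega
    · rintro (rfl | rfl) <;> omega
  · constructor
    · omega
    · rintro (rfl | rfl) <;> omega
  · constructor
    · omega
    · rintro (rfl | rfl) <;> omega

end IsStrip

theorem exists_clockwiseVertexList {P : Finset (ℤ × ℤ)} {n : ℕ} {L U : ℤ → ℤ}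
    (hP : IsStrip P n L U) (π s : Equiv.Perm (Fin n)) (c : ℕ → Fin n) (hc0 : (c 0 : ℕ) = 0)
    (hcn : c n = c 0) (hinj : ∀ k < n, ∀ l < n, c k = c l → k = l)
    (hsurj : ∀ i, ∃ k < n, c k = i) (hsucc : ∀ k < n, c (k + 1) = s (c k))
    (hstep : ∀ i : Fin n, IsBoundaryStep n L U ((i : ℕ) + 1 : ℤ) ((s i : ℕ) + 1 : ℤ)
      ((π i : ℕ) + 1 : ℤ) ((π (s i) : ℕ) + 1 : ℤ)) :
    ∃ (r : ℕ) (A : ℕ → ℤ × ℤ), IsClockwiseVertexList P r A ∧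
      Represents {v | ∃ k ≤ r, v = A (2 * k + 1)} π ∧
      Represents {v | ∃ k ≤ r, v = A (2 * k + 2)} (s.trans π) := by
  have hn := hP.two_le
  have hne : ∀ i, s i ≠ i := fun i h => by
    have := hstep i
    rw [h] at this
    rcases this with ⟨_, h, _⟩ | ⟨_, h, _⟩ <;> omega
  have hneπ : ∀ i, ((π i : ℕ) + 1 : ℤ) ≠ (π (s i) : ℕ) + 1 := fun i h =>
    hne i (π.injective (Fin.ext (by omega)))
  -- The abscissa changes after every even vertex and the ordinate after every odd one, whence the
  -- two halvings.
  set A : ℕ → ℤ × ℤ := fun m =>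
    (((c ((m - 1) / 2) : ℕ) : ℤ) + 1, ((π (c (m / 2)) : ℕ) : ℤ) + 1) with hA
  have odd : ∀ k, A (2 * k + 1) = (((c k : ℕ) : ℤ) + 1, ((π (c k) : ℕ) : ℤ) + 1) := by
    intro k
    simp only [hA]
    rw [show (2 * k + 1 - 1) / 2 = k by omega, show (2 * k + 1) / 2 = k by omega]
  have even : ∀ k < n,
      A (2 * k + 2) = (((c k : ℕ) : ℤ) + 1, ((π (s (c k)) : ℕ) : ℤ) + 1) := by
    intro k hk
    simp only [hA]
    rw [show (2 * k + 2 - 1) / 2 = k by omega, show (2 * k + 2) / 2 = k + 1 by omega, hsucc k hk]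
  have index : ∀ m, 1 ≤ m → m ≤ 2 * (n - 1 + 1) →
      ∃ k < n, m = 2 * k + 1 ∨ m = 2 * k + 2 := fun m h₁ h₂ =>
    ⟨(m - 1) / 2, by omega, by omega⟩
  refine ⟨n - 1, A, ⟨?_, ?_, ?_, ?_, ?_⟩, ?_, ?_⟩
  · rintro m ⟨hm₁, hm₂⟩ l ⟨hl₁, hl₂⟩ h
    obtain ⟨k, hk, hmk⟩ := index m hm₁ hm₂
    obtain ⟨k', hk', hlk⟩ := index l hl₁ hl₂
    have h₁ : c k = c k' := by
      have := congrArg Prod.fst h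
      simp only [hA] at this
      rw [show (m - 1) / 2 = k by omega, show (l - 1) / 2 = k' by omega] at this
      exact Fin.ext (by omega)
    obtain rfl := hinj k hk k' hk' h₁
    rcases hmk with rfl | rfl <;> rcases hlk with rfl | rfl
    · rfl
    · rw [odd, even k hk] at h
      exact absurd (congrArg Prod.snd h) (hneπ _)
    · rw [odd, even k hk] at h
      exact absurd (congrArg Prod.snd h) (hneπ _).symm
    · rfl
  · ext ⟨x, y⟩
    constructor
    · rintro ⟨m, ⟨hm₁, hm₂⟩, h⟩
      obtain ⟨k, hk, rfl | rfl⟩ := index m hm₁ hm₂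
      · rw [odd] at h
        rw [← h]
        exact (hP.isVertex_iff (hstep (c k)) (hneπ _)).2 (Or.inl rfl)
      · rw [even k hk] at h
        rw [← h]
        exact (hP.isVertex_iff (hstep (c k)) (hneπ _)).2 (Or.inr rfl)
    · intro hv
      have hx := hP.ordinate_of_isVertex hv
      obtain ⟨i, rfl⟩ : ∃ i : Fin n, ((i : ℕ) : ℤ) + 1 = x :=
        ⟨⟨(x - 1).toNat, by omega⟩, by simp only; omega⟩
      obtain ⟨k, hk, rfl⟩ := hsurj i
      rcases (hP.isVertex_iff (hstep (c k)) (hneπ _)).1 hv with rfl | rfl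
      · exact ⟨2 * k + 1, ⟨by omega, by omega⟩, odd k⟩
      · exact ⟨2 * k + 2, ⟨by omega, by omega⟩, even k hk⟩
  · rw [show n - 1 + 1 = n by omega, odd, hcn]
  · intro m hm₁ hm₂
    obtain ⟨k, hk, rfl | rfl⟩ := index m hm₁ hm₂
    · rw [odd, show 2 * k + 1 + 1 = 2 * k + 2 by rfl, even k hk]
      exact hP.vertical_side (hstep (c k)) (hneπ _)
    · rw [show 2 * k + 2 + 1 = 2 * (k + 1) + 1 by ring, odd, even k hk, hsucc k hk]
      exact hP.horizontal_side (hstep (c k))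
  · rintro ⟨x, y⟩ hv
    have h₁ : A 1 = (((c 0 : ℕ) : ℤ) + 1, ((π (c 0) : ℕ) : ℤ) + 1) := odd 0
    rw [h₁]
    have hx := hP.ordinate_of_isVertex hv
    rcases (show 1 ≤ x by omega).lt_or_eq with hx | rfl
    · left
      simp only
      omega
    · right
      have hc : ((c 0 : ℕ) : ℤ) + 1 = 1 := by omega
      have hs := hstep (c 0)
      rw [hc] at hs
      rcases (hP.isVertex_iff hs (hneπ _)).1 hv with rfl | rfl
      · exact ⟨hc, le_rfl⟩
      · refine ⟨hc, ?_⟩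
        -- The side at abscissa `1` goes up, from `L 1` to `U 1`.
        have := hP.lt 1
        rcases hs with ⟨_, h₂, h₃, h₄, h₅⟩ | ⟨_, h₂, h₃, h₄, h₅⟩
        · have := h₄ 1 le_rfl h₂
          simp only
          omega
        · omega
  · ext v
    constructor
    · rintro ⟨k, hk, rfl⟩
      exact ⟨c k, (odd k).symm⟩
    · rintro ⟨i, rfl⟩
      obtain ⟨k, hk, rfl⟩ := hsurj i
      exact ⟨k, by omega, (odd k).symm⟩
  · ext v
    constructor
    · rintro ⟨k, hk, rfl⟩
      exact ⟨c k, (even k (by omega)).symm⟩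
    · rintro ⟨i, rfl⟩
      obtain ⟨k, hk, rfl⟩ := hsurj i
      exact ⟨k, by omega, (even k hk).symm⟩

/-! ### From a lower unimodal sublist to a convex permutomino -/

/-- The lower boundary and the upper boundary of a strip given by the permutation `π`: the height
of the lower boundary at the column `x` is the entry at the last position of `σ(π)` up to `x`, the
height of the upper boundary is the entry at the first position of `μ(π)` after `x`. -/
structure IsBoundaryOf {n : ℕ} (π : Equiv.Perm (Fin n)) (L U : ℤ → ℤ) : Prop where
  lower : ∀ x : ℤ, 1 ≤ x → x < n → ∃ j ∈ sigmaPositions π, (j : ℤ) + 1 ≤ x ∧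
    L x = (π j : ℤ) + 1 ∧ ∀ t ∈ sigmaPositions π, (t : ℤ) + 1 ≤ x → t ≤ j
  upper : ∀ x : ℤ, 1 ≤ x → x < n → ∃ j ∈ muPositions π, x ≤ (j : ℤ) ∧
    U x = (π j : ℤ) + 1 ∧ ∀ t ∈ muPositions π, x ≤ (t : ℤ) → j ≤ t

theorem exists_isBoundaryOf {n : ℕ} (π : Equiv.Perm (Fin n)) : ∃ L U, IsBoundaryOf π L U := by
  classical
  have lower : ∀ x : ℤ, ∃ l : ℤ, 1 ≤ x → x < n → ∃ j ∈ sigmaPositions π, (j : ℤ) + 1 ≤ x ∧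
      l = (π j : ℤ) + 1 ∧ ∀ t ∈ sigmaPositions π, (t : ℤ) + 1 ≤ x → t ≤ j := by
    intro x
    by_cases hx : 1 ≤ x ∧ x < n
    swap
    · exact ⟨0, fun h₁ h₂ => absurd ⟨h₁, h₂⟩ hx⟩
    obtain ⟨j, hj, hmax⟩ := (Finset.univ.filter fun j : Fin n =>
      j ∈ sigmaPositions π ∧ (j : ℤ) + 1 ≤ x).exists_max_image id
      ⟨⟨0, by omega⟩, Finset.mem_filter.2 ⟨Finset.mem_univ _, Or.inl rfl, by simp; omega⟩⟩
    have hj := (Finset.mem_filter.1 hj).2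
    exact ⟨_, fun _ _ => ⟨j, hj.1, hj.2, rfl, fun t ht htx =>
      hmax t (Finset.mem_filter.2 ⟨Finset.mem_univ _, ht, htx⟩)⟩⟩
  have upper : ∀ x : ℤ, ∃ u : ℤ, 1 ≤ x → x < n → ∃ j ∈ muPositions π, x ≤ (j : ℤ) ∧
      u = (π j : ℤ) + 1 ∧ ∀ t ∈ muPositions π, x ≤ (t : ℤ) → j ≤ t := by
    intro x
    by_cases hx : 1 ≤ x ∧ x < n
    swap
    · exact ⟨0, fun h₁ h₂ => absurd ⟨h₁, h₂⟩ hx⟩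
    obtain ⟨j, hj, hmin⟩ := (Finset.univ.filter fun j : Fin n =>
      j ∈ muPositions π ∧ x ≤ (j : ℤ)).exists_min_image id
      ⟨⟨n - 1, by omega⟩, Finset.mem_filter.2 ⟨Finset.mem_univ _,
        last_mem_mu π (by simp only; omega), by simp only; omega⟩⟩
    have hj := (Finset.mem_filter.1 hj).2
    exact ⟨_, fun _ _ => ⟨j, hj.1, hj.2, rfl, fun t ht htx =>
      hmin t (Finset.mem_filter.2 ⟨Finset.mem_univ _, ht, htx⟩)⟩⟩
  choose L hL using lower
  choose U hU using upper
  exact ⟨L, U, hL, hU⟩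

namespace IsBoundaryOf

variable {n : ℕ} {π : Equiv.Perm (Fin n)} {L U : ℤ → ℤ}

theorem lower_eq (hB : IsBoundaryOf π L U) {x : ℤ} {j : Fin n} (hx : 1 ≤ x) (hxn : x < n)
    (hj : j ∈ sigmaPositions π) (hjx : (j : ℤ) + 1 ≤ x)
    (h : ∀ t ∈ sigmaPositions π, (t : ℤ) + 1 ≤ x → t ≤ j) : L x = (π j : ℤ) + 1 := by
  obtain ⟨i, hi, hix, hL, hmax⟩ := hB.lower x hx hxn
  rw [hL, le_antisymm (h i hi hix) (hmax j hj hjx)]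

theorem upper_eq (hB : IsBoundaryOf π L U) {x : ℤ} {j : Fin n} (hx : 1 ≤ x) (hxn : x < n)
    (hj : j ∈ muPositions π) (hjx : x ≤ (j : ℤ))
    (h : ∀ t ∈ muPositions π, x ≤ (t : ℤ) → j ≤ t) : U x = (π j : ℤ) + 1 := by
  obtain ⟨i, hi, hix, hU, hmin⟩ := hB.upper x hx hxn
  rw [hU, le_antisymm (hmin j hj hjx) (h i hi hix)]

/-- At a position other than the ends, only one of the two boundaries jumps, because `μ(π)` and
`σ(π)` share no position there. -/
theorem isBoundaryStep (hB : IsBoundaryOf π L U) {i j : Fin n}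
    (h : CyclicStep (muPositions π) (sigmaPositions π) i j) :
    IsBoundaryStep n L U ((i : ℕ) + 1 : ℤ) ((j : ℕ) + 1 : ℤ) ((π i : ℕ) + 1 : ℤ)
      ((π j : ℕ) + 1 : ℤ) := by
  rcases h with ⟨hi, hj, hij, h⟩ | ⟨hi, hj, hij, h⟩
  · rw [Fin.lt_def] at hij
    refine Or.inl ⟨by omega, by omega, by omega, fun z hz hz' => ?_, ?_⟩
    · exact hB.upper_eq (by omega) (by omega) hj (by omega) fun t ht htz =>
        h t ht (by rw [Fin.lt_def]; omega)
    · by_cases hi0 : (i : ℕ) = 0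
      · refine Or.inl ⟨by omega, ?_⟩
        exact hB.lower_eq (by omega) (by omega) (Or.inl hi0) (by omega) fun t _ ht => by
          rw [Fin.le_def]; omega
      · refine Or.inr ⟨by omega, ?_, ?_⟩
        · exact hB.upper_eq (by omega) (by omega) hi (by omega) fun t _ ht => by
            rw [Fin.le_def]; omega
        · have hiσ : i ∉ sigmaPositions π := by
            rintro (h | h | h)
            · omega
            · omega
            · exact h hi
          obtain ⟨l, hl, hlx, hL, hmax⟩ := hB.lower ((i : ℤ) + 1) (by omega) (by omega)
          have hli : (l : ℕ) ≠ i := fun h => hiσ (Fin.ext h ▸ hl)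
          rw [hL]
          exact hB.lower_eq (by omega) (by omega) hl (by omega) fun t ht htx =>
            hmax t ht (by omega)
  · rw [Fin.lt_def] at hij
    refine Or.inr ⟨by omega, by omega, by omega, fun z hz hz' => ?_, ?_⟩
    · exact hB.lower_eq (by omega) (by omega) hj (by omega) fun t ht htz =>
        h t ht (by rw [Fin.lt_def]; omega)
    · by_cases hin : (i : ℕ) + 1 = n
      · refine Or.inl ⟨by omega, ?_⟩
        exact hB.upper_eq (by omega) (by omega) (last_mem_mu π hin) (by omega) fun t _ ht => by
          rw [Fin.le_def]; omega
      · refine Or.inr ⟨by omega, ?_, ?_⟩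
        · exact hB.lower_eq (by omega) (by omega) hi (by omega) fun t _ ht => by
            rw [Fin.le_def]; omega
        · have hiμ : i ∉ muPositions π := by
            rcases hi with h | h | h
            · omega
            · omega
            · exact h
          obtain ⟨l, hl, hlx, hU, hmin⟩ := hB.upper (i : ℤ) (by omega) (by omega)
          have hli : (l : ℕ) ≠ i := fun h => hiμ (Fin.ext h ▸ hl)
          rw [add_sub_cancel_right, hU]
          exact (hB.upper_eq (by omega) (by omega) hl (by omega) fun t ht htx =>
            hmin t ht (by omega)).symm

end IsBoundaryOf

/-- An entry of `σ(π)` is less than every later entry of `μ(π)`. -/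
theorem sigma_lt_mu {n : ℕ} {π : Equiv.Perm (Fin n)} {a z : Fin n} (ha : (a : ℕ) = 0)
    (hz : (z : ℕ) + 1 = n) (h : π a < π z) (hσ : IsLowerUnimodalOn π (sigmaPositions π))
    {i j : Fin n} (hi : i ∈ sigmaPositions π) (hj : j ∈ muPositions π) (hij : i ≤ j)
    (hiz : i ≠ z) (hja : j ≠ a) : π i < π j := by
  have hiz' : i < z := lt_of_le_of_ne (by rw [Fin.le_def]; omega) hiz
  have ha' : a ≤ i := by rw [Fin.le_def]; omega
  have hne : i ≠ j := by
    rintro rfl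
    rcases hi with hi | hi | hi
    · exact hja (Fin.ext (by omega))
    · exact hiz (Fin.ext (by omega))
    · exact hi hj
  rcases hj with hj | hj
  · exact hj i (lt_of_le_of_ne hij hne)
  · have h₁ : π z ≤ π j := by
      rcases (show j ≤ z by rw [Fin.le_def]; omega).eq_or_lt with rfl | h
      · exact le_rfl
      · exact (hj z h).le
    -- It remains to compare with the last entry: on the increasing part this is monotonicity, on
    -- the decreasing part it goes through `π a < π z`.
    refine lt_of_lt_of_le ?_ h₁
    obtain ⟨k, hk, hanti, hmono⟩ := hσ
    rcases le_total k i with hki | hik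
    · exact hmono ⟨hi, hki⟩ ⟨Or.inr (Or.inl hz), hki.trans hiz'.le⟩ hiz'
    · refine lt_of_le_of_lt ?_ h
      exact hanti.antitoneOn ⟨Or.inl ha, ha'.trans hik⟩ ⟨hi, hik⟩ ha'

/-- With `min_le_of_mem_mu`, this yields the row convexity of the strip. -/
theorem IsLowerUnimodalOn.le_max {n : ℕ} {π : Equiv.Perm (Fin n)} {S : Set (Fin n)}
    (h : IsLowerUnimodalOn π S) {a b c : Fin n} (ha : a ∈ S) (hb : b ∈ S) (hc : c ∈ S)
    (hab : a ≤ b) (hbc : b ≤ c) : π b ≤ π a ∨ π b ≤ π c := by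
  obtain ⟨k, hk, hanti, hmono⟩ := h
  rcases le_total b k with hbk | hkb
  · exact Or.inl (hanti.antitoneOn ⟨ha, hab.trans hbk⟩ ⟨hb, hbk⟩ hab)
  · exact Or.inr (hmono.monotoneOn ⟨hb, hkb⟩ ⟨hc, hkb.trans hbc⟩ hbc)

theorem min_le_of_mem_mu {n : ℕ} {π : Equiv.Perm (Fin n)} {a b c : Fin n}
    (hb : b ∈ muPositions π) (hab : a ≤ b) (hbc : b ≤ c) : π a ≤ π b ∨ π c ≤ π b := by
  rcases hb with hb | hb
  · left
    rcases hab.eq_or_lt with rfl | h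
    · exact le_rfl
    · exact (hb a h).le
  · right
    rcases hbc.eq_or_lt with rfl | h
    · exact le_rfl
    · exact (hb c h).le

theorem exists_strip_cells {n : ℤ} {L U : ℤ → ℤ} (hn : 2 ≤ n)
    (lt : ∀ x, 1 ≤ x → x < n → L x < U x)
    (lt_succ : ∀ x, 1 ≤ x → x + 1 < n → L x < U (x + 1))
    (succ_lt : ∀ x, 1 ≤ x → x + 1 < n → L (x + 1) < U x) :
    ∃ P : Finset (ℤ × ℤ), IsStrip P n L U := by
  refine ⟨(Finset.Ico 1 n).biUnion fun x => (Finset.Ico (L x) (U x)).image fun y => (x, y),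
    hn, fun x y => ?_, lt, lt_succ, succ_lt⟩
  simp only [Finset.mem_biUnion, Finset.mem_image, Finset.mem_Ico, Prod.mk.injEq]
  constructor
  · rintro ⟨x, hx, y, hy, rfl, rfl⟩
    exact ⟨hx.1, hx.2, hy⟩
  · rintro ⟨h₁, h₂, h₃⟩
    exact ⟨x, ⟨h₁, h₂⟩, y, h₃, rfl, rfl⟩

theorem IsStrip.card_columns {P : Finset (ℤ × ℤ)} {n : ℕ} {L U : ℤ → ℤ} (hP : IsStrip P n L U) :
    (P.image Prod.fst).card + 1 = n := by
  have hn := hP.two_le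
  have : P.image Prod.fst = Finset.Icc 1 ((n : ℤ) - 1) := by
    ext x
    simp only [Finset.mem_image, Finset.mem_Icc]
    constructor
    · rintro ⟨⟨a, b⟩, h, rfl⟩
      rw [hP.mem] at h
      simp only
      omega
    · rintro ⟨h₁, h₂⟩
      exact ⟨(x, L x), (hP.mem _ _).2 ⟨h₁, by omega, le_rfl, hP.lt x h₁ (by omega)⟩, rfl⟩
  rw [this, Int.card_Icc]
  omega

/-- Between a column touching the bottom and one touching the top, no row can be skipped. -/
theorem IsStrip.card_rows {P : Finset (ℤ × ℤ)} {n : ℕ} {L U : ℤ → ℤ} (hP : IsStrip P n L U)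
    (hL : ∀ x : ℤ, 1 ≤ x → x < n → 1 ≤ L x) (hU : ∀ x : ℤ, 1 ≤ x → x < n → U x ≤ n)
    {a b : ℤ} (ha : 1 ≤ a) (han : a < n) (hLa : L a = 1) (hb : 1 ≤ b) (hbn : b < n)
    (hUb : U b = n) : (P.image Prod.snd).card + 1 = n := by
  have hn := hP.two_le
  have : P.image Prod.snd = Finset.Icc 1 ((n : ℤ) - 1) := by
    ext y
    simp only [Finset.mem_image, Finset.mem_Icc]
    constructor
    · rintro ⟨⟨x, y⟩, h, rfl⟩
      rw [hP.mem] at h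
      have := hL x h.1 h.2.1
      have := hU x h.1 h.2.1
      simp only
      omega
    · rintro ⟨h₁, h₂⟩
      by_cases hy : U a ≤ y
      · rcases le_total a b with hab | hab
        · obtain ⟨x, -, -, hx⟩ := hP.exists_column (y := y) ha hab hbn (by omega)
          exact ⟨_, hx, rfl⟩
        · obtain ⟨x, -, -, hx⟩ := hP.exists_column (y := y) hb hab han (by omega)
          exact ⟨_, hx, rfl⟩
      · exact ⟨(a, y), by rw [hP.mem]; omega, rfl⟩
  rw [this, Int.card_Icc]
  omega

theorem IsLowerUnimodalOn.exists_permutomino {n : ℕ} (hn : 2 ≤ n) {π : Equiv.Perm (Fin n)}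
    {a z : Fin n} (ha : (a : ℕ) = 0) (hz : (z : ℕ) + 1 = n) (h : π a < π z)
    (hσ : IsLowerUnimodalOn π (sigmaPositions π)) :
    ∃ Q : Permutomino n, Q.IsConvex ∧ Q.perm₁ = π := by
  obtain ⟨L, U, hB⟩ := exists_isBoundaryOf π
  -- The bound `x ≤ y + 1` puts the position defining `L x` no later than the one defining `U y`; it
  -- covers equal and adjacent columns.
  have lt_of_close : ∀ x y : ℤ, 1 ≤ x → x < n → 1 ≤ y → y < n → x ≤ y + 1 → L x < U y := by
    intro x y hx hxn hy hyn hxy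
    obtain ⟨i, hi, hix, hLi, -⟩ := hB.lower x hx hxn
    obtain ⟨j, hj, hjy, hUj, -⟩ := hB.upper y hy hyn
    have := sigma_lt_mu ha hz h hσ hi hj (by rw [Fin.le_def]; omega)
      (by rintro rfl; omega) (by rintro rfl; omega)
    rw [Fin.lt_def] at this
    omega
  obtain ⟨P, hP⟩ := exists_strip_cells (n := n) (L := L) (U := U) (by omega)
    (fun x h₁ h₂ => lt_of_close x x h₁ h₂ h₁ h₂ (by omega))
    (fun x h₁ h₂ => lt_of_close x (x + 1) h₁ (by omega) (by omega) h₂ (by omega))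
    (fun x h₁ h₂ => lt_of_close (x + 1) x (by omega) h₂ h₁ (by omega) le_rfl)
  have hL : ∀ x : ℤ, 1 ≤ x → x < n → 1 ≤ L x := fun x h₁ h₂ => by
    obtain ⟨i, -, -, h, -⟩ := hB.lower x h₁ h₂
    omega
  have hU : ∀ x : ℤ, 1 ≤ x → x < n → U x ≤ n := fun x h₁ h₂ => by
    obtain ⟨i, -, -, h, -⟩ := hB.upper x h₁ h₂
    omega
  obtain ⟨p, hp, hpn, hLp⟩ : ∃ p : ℤ, 1 ≤ p ∧ p < n ∧ L p = 1 := by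
    obtain ⟨i, hi⟩ := π.surjective ⟨0, by omega⟩
    have hi0 : (π i : ℕ) = 0 := by rw [hi]
    have hiz : i ≠ z := by
      rintro rfl
      rw [Fin.lt_def] at h
      omega
    have hin : (i : ℕ) + 1 ≠ n := fun h => hiz (Fin.ext (by omega))
    refine ⟨i + 1, by omega, by omega, ?_⟩
    rw [hB.lower_eq (j := i) (by omega) (by omega) ?_ le_rfl
      fun t _ ht => by rw [Fin.le_def]; omega]
    · omega
    · by_cases hia : i = a
      · exact Or.inl (hia ▸ ha)
      · have hai : (a : ℕ) < i := by
          have : (i : ℕ) ≠ a := fun h => hia (Fin.ext h)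
          omega
        refine Or.inr (Or.inr ?_)
        rintro (h' | h')
        · have := h' a hai
          rw [Fin.lt_def] at this
          omega
        · have := h' z (by rw [Fin.lt_def]; omega)
          rw [Fin.lt_def] at this
          omega
  -- The greatest entry is a left-right maximum and is not first, so the column just before it
  -- reaches height `n`.
  obtain ⟨q, hq, hqn, hUq⟩ : ∃ q : ℤ, 1 ≤ q ∧ q < n ∧ U q = n := by
    obtain ⟨i, hi⟩ := π.surjective ⟨n - 1, by omega⟩
    have hin : (π i : ℕ) = n - 1 := by rw [hi]
    have hia : i ≠ a := by
      rintro rfl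
      rw [Fin.lt_def] at h
      omega
    have hi0 : (i : ℕ) ≠ 0 := fun h => hia (Fin.ext (by omega))
    refine ⟨i, by omega, by omega, ?_⟩
    rw [hB.upper_eq (j := i) (by omega) (by omega) (Or.inl fun j hj => ?_) le_rfl
      fun t _ ht => by rw [Fin.le_def]; omega]
    · omega
    · have : (π j : ℕ) ≠ π i := fun h => hj.ne (π.injective (Fin.ext h))
      rw [Fin.lt_def]
      omega
  obtain ⟨s, c, hc0, hcn, hinj, hsurj, hsucc, hstep⟩ := exists_cyclic_order hn π
  have row : IsRowConvex P := by
    intro y x₁ x x₂ h₁ h₂ h₃ h₄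
    rw [hP.mem] at *
    obtain ⟨i₁, hi₁, hix₁, hL₁, hm₁⟩ := hB.lower x₁ (by omega) (by omega)
    obtain ⟨i, hi, hix, hL, hm⟩ := hB.lower x (by omega) (by omega)
    obtain ⟨i₂, hi₂, hix₂, hL₂, hm₂⟩ := hB.lower x₂ (by omega) (by omega)
    obtain ⟨j₁, hj₁, hjx₁, hU₁, hn₁⟩ := hB.upper x₁ (by omega) (by omega)
    obtain ⟨j, hj, hjx, hU, hn⟩ := hB.upper x (by omega) (by omega)
    obtain ⟨j₂, hj₂, hjx₂, hU₂, hn₂⟩ := hB.upper x₂ (by omega) (by omega)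
    have hlow := hσ.le_max hi₁ hi hi₂ (hm i₁ hi₁ (by omega)) (hm₂ i hi (by omega))
    have hupp := min_le_of_mem_mu hj (hn₁ j hj (by omega)) (hn j₂ hj₂ (by omega))
    simp only [Fin.le_def] at hlow hupp
    omega
  have placed : IsPlaced P := by
    refine ⟨?_, ⟨(1, L 1), ?_, rfl⟩, ⟨(p, 1), ?_, rfl⟩⟩
    · rintro ⟨x, y⟩ hxy
      rw [hP.mem] at hxy
      have := hL x hxy.1 hxy.2.1
      simp only
      omega
    · have := hP.lt 1 le_rfl (by omega)
      rw [hP.mem]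
      omega
    · have := hP.lt p hp hpn
      rw [hP.mem]
      omega
  exact ⟨⟨P, π, s.trans π, hP.isPolyomino, hP.hasNoHoles, placed, hP.card_columns,
    hP.card_rows hL hU hp hpn hLp hq hqn hUq,
    exists_clockwiseVertexList hP π s c hc0 hcn hinj hsurj hsucc
      fun i => hB.isBoundaryStep (hstep i)⟩, ⟨hP.isColumnConvex, row⟩, rfl⟩

/-! ### Direct differences and the conclusion -/

theorem IsDirectDifference.last_lt_first {n : ℕ} {π : Equiv.Perm (Fin n)}
    (h : IsDirectDifference π) {a z : Fin n} (ha : (a : ℕ) = 0) (hz : (z : ℕ) + 1 = n) :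
    π z < π a := by
  obtain ⟨m, m', hm, hm', rfl, θ, θ', rfl⟩ := h
  obtain rfl : a = Fin.castAdd m' ⟨0, hm⟩ := Fin.ext ha
  obtain rfl : z = Fin.natAdd m ⟨m' - 1, Nat.sub_lt hm' Nat.one_pos⟩ := Fin.ext (by simp; omega)
  simp only [directDifference, Fin.lt_def, Equiv.permCongr_apply, finCongr_refl,
    Equiv.refl_symm, Equiv.refl_apply, Equiv.trans_apply, finSumFinEquiv_symm_apply_castAdd,
    finSumFinEquiv_symm_apply_natAdd, Equiv.sumCongr_apply, Sum.map_inl, Sum.map_inr,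
    Equiv.sumComm_apply, Sum.swap_inl, Sum.swap_inr, finSumFinEquiv_apply_left,
    finSumFinEquiv_apply_right, finCongr_apply, Fin.val_cast, Fin.val_castAdd, Fin.val_natAdd]
  omega

theorem mainTheorem10 (n : ℕ) (hn : 0 < n) (π : Equiv.Perm (Fin n))
    (h : π ⟨0, hn⟩ < π ⟨n - 1, Nat.sub_lt hn Nat.one_pos⟩) :
    (π ∈ convexPermutominoPerms n ↔ IsLowerUnimodalOn π (sigmaPositions π)) ∧
      ¬ IsDirectDifference π := by
  have hlast : n - 1 + 1 = n := by omega
  have hn2 : 2 ≤ n := by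
    by_contra hcon
    obtain rfl : n = 1 := by omega
    exact h.ne rfl
  refine ⟨⟨?_, fun hσ => Or.inr (hσ.exists_permutomino hn2 rfl hlast h)⟩, fun hd =>
    lt_asymm h (hd.last_lt_first rfl hlast)⟩
  rintro (rfl | ⟨Q, hQ, rfl⟩)
  · omega
  · exact hQ.isLowerUnimodalOn
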